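/- A $2$-VASS $V$ consists of a finite alphabet $\Sigma$, a finite set of states $Q$, an initial configuration $c_0 \in Q\times\mathbb{N}^2$, a finite set of final configurations $F\subseteq Q\times\mathbb{N}^2$ and a finite transition relation $\delta\subseteq Q\times\Sigma\times\mathbb{Z}^2\times Q$. A transition $(s,a,v,s')\in\delta$ reads the letter $a$; it can be fired in a configuration $q(u)$ if and only if $q=s$ and $u+v\ge 0$ componentwise, and it then leads to $s'(u+v)$. A run is a finite sequence of transitions fired one after another. A run is accepting if it starts in $c_0$ and ends in a configuration $q(u)$ such that $u\ge u'$ componentwise for some $q(u')\in F$. The language $L(V)\subseteq\Sigma^*$ is the set of words read by accepting runs. $V$ is unambiguous if for every $w\in L(V)$ there is exactly one accepting run over $w$. The following problem is undecidable: given an unambiguous $2$-VASS $A$ and a (nondeterministic, i.e. arbitrary) $2$-VASS $B$ over the same finite alphabet, determine whether $L(A)=L(B)$. That is, no algorithm, given (finite descriptions of) any such $A$ and $B$, always halts and correctly decides whether $L(A)=L(B)$; nothing is required of the algorithm on inputs in which $A$ is not unambiguous. -/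

import Mathlib

/-- A `k`-dimensional vector addition system with states, over the finite alphabet `σ` and with the
finite set of states `Q`: an initial configuration, a finite set of final configurations and a
finite transition relation (source state, letter, effect, target state). -/
structure VASS (k : ℕ) (σ Q : Type*) [Finite σ] [Finite Q] where
  /-- the initial configuration -/
  init : Q × (Fin k → ℕ)
  /-- the finite set of final configurations -/
  final : Finset (Q × (Fin k → ℕ))
  /-- the transition relation -/
  trans : Finset (Q × σ × (Fin k → ℤ) × Q)

namespace VASS

/-- Configurations: a state together with a vector of nonnegative counter values. -/
abbrev Config (k : ℕ) (Q : Type*) := Q × (Fin k → ℕ)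

/-- Transitions: source state, letter, effect, target state. -/
abbrev Transition (k : ℕ) (σ Q : Type*) := Q × σ × (Fin k → ℤ) × Q

/-- The letter which a transition reads. -/
def Transition.letter {k : ℕ} {σ Q : Type*} (t : Transition k σ Q) : σ := t.2.1

/-- The transition `(s, a, v, s')` can be fired in the configuration `q(u)` iff `q = s` and
`u + v` is nonnegative; it then leads to the configuration `s'(u + v)`. -/
def Fires {k : ℕ} {σ Q : Type*} (t : Transition k σ Q) (c c' : Config k Q) : Prop :=
  match t with
  | (s, _, v, s') => c.1 = s ∧ c'.1 = s' ∧ ∀ i, (c'.2 i : ℤ) = (c.2 i : ℤ) + v i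

section Semantics

variable {k : ℕ} {σ Q : Type*} [Finite σ] [Finite Q]

/-- `V.IsRun c ρ c'`: the sequence `ρ` of transitions of `V` is a run from `c` to `c'`. -/
inductive IsRun (V : VASS k σ Q) : Config k Q → List (Transition k σ Q) → Config k Q → Prop
  | nil (c : Config k Q) : IsRun V c [] c
  | cons {t : Transition k σ Q} {c c' c'' : Config k Q} {ρ : List (Transition k σ Q)} :
      t ∈ V.trans → Fires t c c' → IsRun V c' ρ c'' → IsRun V c (t :: ρ) c''

/-- A configuration is accepting if it covers some final configuration. -/
def IsAccepting (V : VASS k σ Q) (c : Config k Q) : Prop :=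
  ∃ d ∈ V.final, d.1 = c.1 ∧ d.2 ≤ c.2

/-- `ρ` is an accepting run of `V` over the word `w`. -/
def IsAcceptingRun (V : VASS k σ Q) (w : List σ) (ρ : List (Transition k σ Q)) : Prop :=
  ρ.map Transition.letter = w ∧ ∃ c, V.IsRun V.init ρ c ∧ V.IsAccepting c

/-- The (coverability) language of `V`: the words read by the accepting runs. -/
def language (V : VASS k σ Q) : Language σ :=
  {w | ∃ ρ, V.IsAcceptingRun w ρ}

/-- `V` is unambiguous if every word of its language has exactly one accepting run. -/
def IsUnambiguous (V : VASS k σ Q) : Prop :=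
  ∀ w ∈ V.language, ∃! ρ, V.IsAcceptingRun w ρ

end Semantics

/-- Finite descriptions of `k`-dimensional VASSs, as inputs of algorithms: the number of letters,
the number of states, the initial configuration, a list of the final configurations and a list of
the transitions. Letters and states are written as natural numbers. -/
abbrev Code (k : ℕ) :=
  ℕ × ℕ × (ℕ × (Fin k → ℕ)) × List (ℕ × (Fin k → ℕ)) × List (ℕ × ℕ × (Fin k → ℤ) × ℕ)

/-- `Describes e V`: the code `e` is a description of `V`, a VASS with alphabet `{0, …, m - 1}` and
states `{0, …, n - 1}`. The finite sets of `V` may be listed in any order. -/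
def Describes {k m n : ℕ} (e : Code k) (V : VASS k (Fin m) (Fin n)) : Prop :=
  match e with
  | (m', n', c₀, F, δ) =>
    m' = m ∧ n' = n ∧ c₀ = ((V.init.1 : ℕ), V.init.2) ∧
    (∀ c, c ∈ F ↔ ∃ d ∈ V.final, c = ((d.1 : ℕ), d.2)) ∧
    (∀ t, t ∈ δ ↔ ∃ s ∈ V.trans, t = ((s.1 : ℕ), (s.2.1 : ℕ), s.2.2.1, (s.2.2.2 : ℕ)))

end VASS

/-!
The halting problem reduces to the question whether a two-counter machine has a complete run: the
values of any number of registers are kept as the Gödel number `∏ p ^ v` in the first counter, which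
is multiplied and divided with the help of the second one. Nondeterministic register machines can
guess the value of a primitive recursive function together with all intermediate results and check
the guess. In particular, a single machine, started with the first counter at `2 ^ n`, has a
complete run if and only if the `n`-th program halts.

A VASS cannot test a counter for zero. Let `A` read a sequence of instructions that is admitted by
the control of the machine and execute it, ignoring the zero tests. It is deterministic, since the
instruction that is read determines the effect. A VASS can, however, certify that a counter is
positive, by subtracting one from it. Let `B` do the same as `A`, but guess a zero test which is
violated and certify this. Then `L(B)` consists of the sequences in `L(A)` that the machine cannot
execute, so `L(A) = L(B)` if and only if the machine has no complete run.
-/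

section RegularLanguages

variable {α : Type*}

theorem isRegular_of_finite {L : Language α} (h : (L : Set (List α)).Finite) : L.IsRegular := by
  refine .of_finite_range_leftQuotient
    ((h.biUnion fun w _ => List.finite_toSet w.tails).finite_subsets.subset ?_)
  rintro _ ⟨x, rfl⟩ y hy
  exact Set.mem_biUnion hy ((List.mem_tails ..).2 (List.suffix_append x y))

theorem leftQuotient_mul (L M : Language α) (x : List α) :
    (L * M).leftQuotient x =
      L.leftQuotient x * M + sSup {N | ∃ a c, x = a ++ c ∧ a ∈ L ∧ M.leftQuotient c = N} := by
  ext y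
  simp only [Language.mem_leftQuotient, Language.mem_add, Language.mem_mul]
  constructor
  · rintro ⟨u, hu, v, hv, huv⟩
    obtain ⟨c, rfl, rfl⟩ | ⟨c, rfl, rfl⟩ := List.append_eq_append_iff.1 huv
    · exact .inr (Set.mem_sUnion.2 ⟨_, ⟨u, c, rfl, hu, rfl⟩, hv⟩)
    · exact .inl ⟨c, hu, v, hv, rfl⟩
  · rintro (⟨c, hc, v, hv, rfl⟩ | h)
    · exact ⟨x ++ c, hc, v, hv, List.append_assoc ..⟩
    · obtain ⟨_, ⟨a, c, rfl, ha, rfl⟩, hy⟩ := Set.mem_sUnion.1 h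
      exact ⟨a, ha, c ++ y, hy, (List.append_assoc ..).symm⟩

theorem isRegular_mul {L M : Language α} (hL : L.IsRegular) (hM : M.IsRegular) :
    (L * M).IsRegular := by
  refine .of_finite_range_leftQuotient ((Set.Finite.image2 (fun N S => N * M + sSup S)
    hL.finite_range_leftQuotient hM.finite_range_leftQuotient.finite_subsets).subset ?_)
  rintro _ ⟨x, rfl⟩
  refine ⟨_, ⟨x, rfl⟩, _, ?_, (leftQuotient_mul L M x).symm⟩
  rintro _ ⟨a, c, -, -, rfl⟩
  exact ⟨c, rfl⟩

open scoped Computability in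
theorem leftQuotient_kstar (L : Language α) {x : List α} (hx : x ≠ []) :
    L∗.leftQuotient x =
      sSup {N | ∃ a c, x = a ++ c ∧ a ∈ L∗ ∧ L.leftQuotient c = N} * L∗ := by
  ext y
  simp only [Language.mem_leftQuotient, Language.mem_mul]
  constructor
  · intro h
    obtain ⟨W, hW, hL⟩ := Language.mem_kstar.1 h
    obtain ⟨as, bs, rfl, rfl, rfl⟩ | ⟨as, b, d, c, bs, rfl, rfl, rfl⟩ :=
      List.flatten_eq_append_iff.1 hW.symm
    · obtain ⟨as, a, rfl⟩ := (List.eq_nil_or_concat' as).resolve_left (by rintro rfl; exact hx rfl)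
      simp only [List.mem_append, List.mem_singleton] at hL
      have ha : a ++ [] ∈ L := by simpa only [List.append_nil] using hL a (.inl (.inr rfl))
      exact ⟨[], Set.mem_sUnion.2 ⟨_, ⟨as.flatten, a, by simp,
          Language.join_mem_kstar fun y hy => hL y (.inl (.inl hy)), rfl⟩, ha⟩,
        bs.flatten, Language.join_mem_kstar fun y hy => hL y (.inr hy), rfl⟩
    · simp only [List.mem_append, List.mem_cons] at hL
      exact ⟨d :: c, Set.mem_sUnion.2 ⟨_, ⟨as.flatten, b, rfl,
          Language.join_mem_kstar fun y hy => hL y (.inl hy), rfl⟩, hL _ (.inr (.inl rfl))⟩,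
        bs.flatten, Language.join_mem_kstar fun y hy => hL y (.inr (.inr hy)), rfl⟩
  · rintro ⟨c, hc, v, hv, rfl⟩
    obtain ⟨_, ⟨a, b, rfl, ha, rfl⟩, hc⟩ := Set.mem_sUnion.1 hc
    have h : a ++ (b ++ c) ++ v ∈ L∗ * L * L∗ :=
      Language.append_mem_mul (Language.append_mem_mul ha hc) hv
    have hle : L∗ * L * L∗ ≤ L∗ :=
      (mul_le_mul_left kstar_mul_le_kstar _).trans (kstar_mul_kstar L).le
    have hmem : a ++ (b ++ c) ++ v ∈ L∗ := hle h
    simpa only [List.append_assoc] using hmem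

open scoped Computability in
theorem isRegular_kstar {L : Language α} (hL : L.IsRegular) : L∗.IsRegular := by
  refine .of_finite_range_leftQuotient (((hL.finite_range_leftQuotient.finite_subsets.image
    fun S => sSup S * L∗).insert L∗).subset ?_)
  rintro _ ⟨x, rfl⟩
  rcases eq_or_ne x [] with rfl | hx
  · exact .inl (Language.leftQuotient_nil _)
  · refine .inr ⟨_, ?_, (leftQuotient_kstar L hx).symm⟩
    rintro _ ⟨a, c, -, -, rfl⟩
    exact ⟨c, rfl⟩

end RegularLanguages

open Relation

section Exec

variable {α S : Type*}

/-- Execution of a sequence of actions, where `step a s t` means that the action `a` can lead from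
the state `s` to the state `t`. -/
def Exec (step : α → S → S → Prop) : List α → S → S → Prop
  | [], s, t => s = t
  | a :: w, s, t => ∃ u, step a s u ∧ Exec step w u t

theorem exec_append {step : α → S → S → Prop} {v w : List α} {s t : S} :
    Exec step (v ++ w) s t ↔ ∃ u, Exec step v s u ∧ Exec step w u t := by
  induction v generalizing s with
  | nil => simp only [List.nil_append, Exec, exists_eq_left']
  | cons a v ih =>
    simp only [List.cons_append, Exec, ih]
    exact ⟨fun ⟨r, hr, u, hu, h⟩ => ⟨u, ⟨r, hr, hu⟩, h⟩,
      fun ⟨u, ⟨r, hr, hu⟩, h⟩ => ⟨r, hr, u, hu, h⟩⟩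

theorem Exec.mono {step step' : α → S → S → Prop} {w : List α} {s t : S}
    (hstep : ∀ a s t, step a s t → step' a s t) (h : Exec step w s t) : Exec step' w s t := by
  induction w generalizing s with
  | nil => exact h
  | cons a w ih => exact h.imp fun _ h => ⟨hstep _ _ _ h.1, ih h.2⟩

end Exec

section Shift

variable {M : Type*}

/-- The relation which replaces a summand `d` by `e`: the effect of a reaction that consumes `d`
and produces `e`. -/
def shift [Add M] (d e s t : M) : Prop :=
  ∃ u, s = u + d ∧ t = u + e

section AddMonoid

variable [AddMonoid M] {s t : M}

theorem shift_zero_left_iff {e : M} : shift 0 e s t ↔ t = s + e := by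
  simp only [shift, add_zero, exists_eq_left']

theorem shift_zero_right_iff {d : M} : shift d 0 s t ↔ s = t + d := by
  simp only [shift, add_zero, exists_eq_right']

theorem comp_shift_zero_right_shift_zero_left (d e : M) :
    Comp (shift d 0) (shift 0 e) = shift d e := by
  ext s t
  simp only [Comp, shift_zero_right_iff, shift_zero_left_iff]
  exact ⟨fun ⟨u, hs, ht⟩ => ⟨u, hs, ht⟩, fun ⟨u, hs, ht⟩ => ⟨u, hs, ht⟩⟩

theorem comp_shift_zero_left (e e' : M) :
    Comp (shift 0 e) (shift 0 e') = shift 0 (e + e') := by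
  ext s t
  simp only [Comp, shift_zero_left_iff, exists_eq_left, add_assoc]

theorem comp_shift_zero_right (d d' : M) :
    Comp (shift d 0) (shift d' 0) = shift (d' + d) 0 := by
  ext s t
  simp only [Comp, shift_zero_right_iff, exists_eq_right, add_assoc]

end AddMonoid

variable [AddCommMonoid M] {d e : M}

theorem exists_add_nsmul_eq_of_reflTransGen_shift {s t : M}
    (h : ReflTransGen (shift d e) s t) : ∃ n : ℕ, s + n • e = t + n • d := by
  induction h with
  | refl => exact ⟨0, by rw [zero_nsmul, zero_nsmul]⟩
  | tail _ hu ih =>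
    obtain ⟨n, hn⟩ := ih
    obtain ⟨u, rfl, rfl⟩ := hu
    refine ⟨n + 1, ?_⟩
    rw [succ_nsmul, succ_nsmul, ← add_assoc, hn]
    abel

theorem reflTransGen_shift_add_nsmul (n : ℕ) (u : M) :
    ReflTransGen (shift d e) (u + n • d) (u + n • e) := by
  induction n generalizing u with
  | zero => simpa only [zero_nsmul] using .refl
  | succ n ih =>
    refine .head ⟨u + n • d, by rw [succ_nsmul, add_assoc], rfl⟩ ?_
    simpa only [succ_nsmul', add_right_comm, ← add_assoc] using ih (u + e)

end Shift

/-- The partial identity which checks the condition `P`. -/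
def check {S : Type*} (P : S → Prop) (s t : S) : Prop :=
  P s ∧ s = t

theorem comp_check {S : Type*} (P Q : S → Prop) :
    Comp (check P) (check Q) = check fun s => P s ∧ Q s := by
  ext s t
  constructor
  · rintro ⟨_, ⟨hP, rfl⟩, hQ, rfl⟩
    exact ⟨⟨hP, hQ⟩, rfl⟩
  · rintro ⟨⟨hP, hQ⟩, rfl⟩
    exact ⟨s, ⟨hP, rfl⟩, hQ, rfl⟩

/-- The instructions of a machine with `k` counters. -/
inductive CounterAction (k : ℕ)
  | inc (i : Fin k)
  | dec (i : Fin k)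
  | test (i : Fin k)

instance {k : ℕ} : Finite (CounterAction k) :=
  .of_surjective (Sum.elim .inc (Sum.elim .dec .test)) fun
    | .inc i => ⟨.inl i, rfl⟩
    | .dec i => ⟨.inr (.inl i), rfl⟩
    | .test i => ⟨.inr (.inr i), rfl⟩

/-- The effect of an instruction on the counters. -/
def CounterAction.Step {k : ℕ} : CounterAction k → (Fin k → ℕ) → (Fin k → ℕ) → Prop
  | inc i => shift 0 (Pi.single i 1)
  | dec i => shift (Pi.single i 1) 0
  | test i => check fun s => s i = 0

/-- A relation between counter values is definable if it is computed by a counter machine. The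
program of the machine is given as the regular language of the sequences of instructions which it
can execute. -/
def Definable {k : ℕ} (R : (Fin k → ℕ) → (Fin k → ℕ) → Prop) : Prop :=
  ∃ L : Language (CounterAction k), L.IsRegular ∧
    ∀ s t, R s t ↔ ∃ w ∈ L, Exec CounterAction.Step w s t

namespace Definable

variable {k : ℕ} {R S : (Fin k → ℕ) → (Fin k → ℕ) → Prop}

theorem of_step (a : CounterAction k) : Definable a.Step :=
  ⟨{[a]}, isRegular_of_finite (Set.finite_singleton [a]), fun s t => by
    refine Iff.trans ?_ (exists_eq_left (a' := [a])).symm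
    simp only [Exec, exists_eq_right]⟩

protected theorem false : Definable (fun _ _ : Fin k → ℕ => False) :=
  ⟨0, isRegular_of_finite Set.finite_empty, fun _ _ => by simp [Language.notMem_zero]⟩

protected theorem eq : Definable (Eq (α := Fin k → ℕ)) :=
  ⟨1, isRegular_of_finite (Set.finite_singleton []), fun s t => by
    simp only [Language.mem_one, exists_eq_left, Exec]⟩

protected theorem or (hR : Definable R) (hS : Definable S) :
    Definable fun s t => R s t ∨ S s t := by
  obtain ⟨L, hL, hLR⟩ := hR
  obtain ⟨M, hM, hMS⟩ := hS
  refine ⟨L + M, hL.add hM, fun s t => ?_⟩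
  simp only [hLR, hMS, Language.mem_add, or_and_right, exists_or]

theorem comp (hR : Definable R) (hS : Definable S) : Definable (Comp R S) := by
  obtain ⟨L, hL, hLR⟩ := hR
  obtain ⟨M, hM, hMS⟩ := hS
  refine ⟨L * M, isRegular_mul hL hM, fun s t => ?_⟩
  simp only [Comp, hLR, hMS, Language.mem_mul]
  constructor
  · rintro ⟨u, ⟨v, hv, hsu⟩, w, hw, hut⟩
    exact ⟨v ++ w, ⟨v, hv, w, hw, rfl⟩, exec_append.2 ⟨u, hsu, hut⟩⟩
  · rintro ⟨_, ⟨v, hv, w, hw, rfl⟩, h⟩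
    obtain ⟨u, hsu, hut⟩ := exec_append.1 h
    exact ⟨u, ⟨v, hv, hsu⟩, w, hw, hut⟩

open scoped Computability in
theorem reflTransGen (hR : Definable R) : Definable (ReflTransGen R) := by
  obtain ⟨L, hL, hLR⟩ := hR
  refine ⟨L∗, isRegular_kstar hL, fun s t => ⟨fun h => ?_, ?_⟩⟩
  · induction h with
    | refl => exact ⟨[], Language.nil_mem_kstar L, rfl⟩
    | tail _ hut ih =>
      obtain ⟨v, hv, hsu⟩ := ih
      obtain ⟨w, hw, hut⟩ := (hLR _ _).1 hut
      exact ⟨v ++ w, kstar_mul_le_kstar (a := L) (Language.append_mem_mul hv hw),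
        exec_append.2 ⟨_, hsu, hut⟩⟩
  · rintro ⟨_, hw, h⟩
    obtain ⟨W, rfl, hW⟩ := Language.mem_kstar.1 hw
    clear hw
    induction W generalizing s with
    | nil => exact h ▸ .refl
    | cons w W ih =>
      rw [List.forall_mem_cons] at hW
      obtain ⟨u, hsu, hut⟩ := exec_append.1 h
      exact .head ((hLR _ _).2 ⟨w, hW.1, hsu⟩) (ih u hW.2 hut)

theorem exists_mem {ι : Type*} (F : Finset ι) {R : ι → (Fin k → ℕ) → (Fin k → ℕ) → Prop}
    (hR : ∀ i, Definable (R i)) : Definable fun s t => ∃ i ∈ F, R i s t := by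
  classical
  induction F using Finset.induction_on with
  | empty => simpa using Definable.false
  | insert i F _ ih =>
    simpa only [Finset.exists_mem_insert] using (hR i).or ih

end Definable

theorem definable_shift {k : ℕ} (d e : Fin k → ℕ) : Definable (shift d e) := by
  suffices h : ∀ d : Fin k → ℕ, Definable (shift d 0) ∧ Definable (shift 0 d) from
    comp_shift_zero_right_shift_zero_left d e ▸ (h d).1.comp (h e).2
  have hadd (d d' : Fin k → ℕ)
      (h : Definable (shift d 0) ∧ Definable (shift 0 d))
      (h' : Definable (shift d' 0) ∧ Definable (shift 0 d')) :
      Definable (shift (d + d') 0) ∧ Definable (shift 0 (d + d')) :=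
    ⟨comp_shift_zero_right d' d ▸ h'.1.comp h.1, comp_shift_zero_left d d' ▸ h.2.comp h'.2⟩
  have hzero : Definable (shift (0 : Fin k → ℕ) 0) := by
    convert Definable.eq (k := k) using 1
    ext s t
    simp [shift, eq_comm]
  have hsmul (i : Fin k) (n : ℕ) : Definable (shift (Pi.single i n : Fin k → ℕ) 0) ∧
      Definable (shift 0 (Pi.single i n : Fin k → ℕ)) := by
    induction n with
    | zero => rw [Pi.single_zero]; exact ⟨hzero, hzero⟩
    | succ n ih => rw [Pi.single_add]; exact hadd _ _ ih ⟨.of_step (.dec i), .of_step (.inc i)⟩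
  intro d
  rw [← Finset.univ_sum_single d]
  exact Finset.sum_induction _ _ hadd ⟨hzero, hzero⟩ fun i _ => hsmul i (d i)

section Affine

/-- The relation on the values of two counters which sends `(c * n + r, 0)` to `(d * n + r, 0)`
for every `n`. -/
def affine (c d r : ℕ) (s t : Fin 2 → ℕ) : Prop :=
  ∃ n, s = ![c * n + r, 0] ∧ t = ![d * n + r, 0]

theorem eq_vec_of_snd_eq_zero {s : Fin 2 → ℕ} (h : s 1 = 0) : s = ![s 0, 0] := by
  ext i
  fin_cases i
  · rfl
  · exact h

theorem reflTransGen_shift_fst_snd_iff {c d x : ℕ} {t : Fin 2 → ℕ} :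
    ReflTransGen (shift ![c, 0] ![0, d]) ![x, 0] t ↔ ∃ n y, x = c * n + y ∧ t = ![y, d * n] := by
  constructor
  · intro h
    obtain ⟨n, hn⟩ := exists_add_nsmul_eq_of_reflTransGen_shift h
    have h0 := congrFun hn 0
    have h1 := congrFun hn 1
    refine ⟨n, t 0, ?_, ?_⟩
    · simpa [mul_comm, add_comm] using h0
    · ext i
      fin_cases i
      · rfl
      · simpa [mul_comm] using h1.symm
  · rintro ⟨n, y, rfl, rfl⟩
    convert reflTransGen_shift_add_nsmul (d := ![c, 0]) (e := ![0, d]) n ![y, 0] using 1 <;>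
      simp [mul_comm, add_comm]

theorem reflTransGen_shift_snd_fst_iff {x y z : ℕ} :
    ReflTransGen (shift ![0, 1] ![1, 0]) ![x, y] ![z, 0] ↔ z = x + y := by
  constructor
  · intro h
    obtain ⟨n, hn⟩ := exists_add_nsmul_eq_of_reflTransGen_shift h
    have h0 := congrFun hn 0
    have h1 := congrFun hn 1
    simp only [Pi.add_apply, Pi.smul_apply, Matrix.cons_val_zero, Matrix.cons_val_one,
      Matrix.cons_val_fin_one, smul_eq_mul, mul_zero, mul_one, add_zero, zero_add] at h0 h1
    omega
  · rintro rfl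
    convert reflTransGen_shift_add_nsmul (d := ![0, 1]) (e := ![1, 0]) y ![x, 0] using 1 <;>
      simp

theorem exists_shift_fst_snd_iff {r x y : ℕ} {t : Fin 2 → ℕ} :
    (∃ u, shift ![r, 0] ![0, r] ![x, y] u ∧ u 0 = 0 ∧ u = t) ↔ x = r ∧ t = ![0, y + r] := by
  constructor
  · rintro ⟨_, ⟨u, hu, rfl⟩, hu', rfl⟩
    have h0 := congrFun hu 0
    have h1 := congrFun hu 1
    simp only [Pi.add_apply, Matrix.cons_val_zero, Matrix.cons_val_one, Matrix.cons_val_fin_one,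
      add_zero] at h0 h1 hu'
    refine ⟨by omega, ?_⟩
    ext i
    fin_cases i <;> simp [h1, hu']
  · rintro ⟨rfl, rfl⟩
    exact ⟨_, ⟨![0, y], by simp, by simp⟩, rfl, rfl⟩

-- Move `c * n` from the first counter to `d * n` on the second one. Moving `r` as well checks that
-- exactly `r` was left, and then everything is moved back.
theorem definable_affine (c d r : ℕ) : Definable (affine c d r) := by
  convert (((Definable.of_step (.test 1)).comp
    (definable_shift ![c, 0] ![0, d]).reflTransGen).comp
    ((definable_shift ![r, 0] ![0, r]).comp (.of_step (.test 0)))).comp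
    ((definable_shift ![0, 1] ![1, 0]).reflTransGen.comp (.of_step (.test 1))) using 1
  ext s t
  simp only [Comp, CounterAction.Step, check]
  constructor
  · rintro ⟨n, rfl, rfl⟩
    exact ⟨_, ⟨_, ⟨_, ⟨rfl, rfl⟩, reflTransGen_shift_fst_snd_iff.2 ⟨n, r, rfl, rfl⟩⟩,
      exists_shift_fst_snd_iff.2 ⟨rfl, rfl⟩⟩,
      _, reflTransGen_shift_snd_fst_iff.2 (Nat.zero_add _).symm, rfl, rfl⟩
  · rintro ⟨u, ⟨v, ⟨_, ⟨hs, rfl⟩, hsv⟩, hvu⟩, _, hut, ht, rfl⟩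
    rw [eq_vec_of_snd_eq_zero hs] at hsv
    obtain ⟨n, y, hn, rfl⟩ := reflTransGen_shift_fst_snd_iff.1 hsv
    obtain ⟨rfl, rfl⟩ := exists_shift_fst_snd_iff.1 hvu
    rw [eq_vec_of_snd_eq_zero ht, reflTransGen_shift_snd_fst_iff, Nat.zero_add] at hut
    exact ⟨n, hn ▸ eq_vec_of_snd_eq_zero hs, hut ▸ eq_vec_of_snd_eq_zero ht⟩

theorem exists_affine_iff_not_dvd {p x : ℕ} (hp : p ≠ 0) {t : Fin 2 → ℕ} :
    (∃ r ∈ Finset.Ioo 0 p, affine p p r ![x, 0] t) ↔ ¬p ∣ x ∧ t = ![x, 0] := by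
  constructor
  · rintro ⟨r, hr, n, hx, rfl⟩
    obtain rfl : x = p * n + r := congrFun hx 0
    rw [Finset.mem_Ioo] at hr
    rw [Nat.dvd_add_right (dvd_mul_right p n)]
    exact ⟨Nat.not_dvd_of_pos_of_lt hr.1 hr.2, rfl⟩
  · rintro ⟨hx, rfl⟩
    refine ⟨x % p, Finset.mem_Ioo.2 ⟨Nat.pos_of_ne_zero (mt Nat.dvd_of_mod_eq_zero hx),
      Nat.mod_lt x (Nat.pos_of_ne_zero hp)⟩, x / p, ?_⟩
    rw [Nat.div_add_mod, and_self]

end Affine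

section Godel

variable {ι : Type*} [Fintype ι]

/-- The Gödel number of the values of registers indexed by `ι`, with the prime `p i` for the
register `i`. -/
def godel (p : ι ↪ Nat.Primes) (v : ι → ℕ) : ℕ :=
  ∏ i, (p i : ℕ) ^ v i

variable (p : ι ↪ Nat.Primes)

theorem godel_ne_zero (v : ι → ℕ) : godel p v ≠ 0 :=
  Finset.prod_ne_zero_iff.2 fun i _ => pow_ne_zero _ (p i).2.ne_zero

theorem godel_add (v w : ι → ℕ) : godel p (v + w) = godel p v * godel p w := by
  simp only [godel, Pi.add_apply, pow_add, Finset.prod_mul_distrib]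

theorem godel_single [DecidableEq ι] (i : ι) : godel p (Pi.single i 1) = p i := by
  rw [godel, Finset.prod_eq_single i] <;> simp +contextual

theorem godel_sumElim_zero {κ : Type*} [Fintype κ] (q : ι ⊕ κ ↪ Nat.Primes) (v : ι → ℕ) :
    godel q (Sum.elim v 0) = godel (Function.Embedding.inl.trans q) v := by
  simp [godel]

theorem factorization_godel (v : ι → ℕ) (i : ι) : (godel p v).factorization (p i) = v i := by
  classical
  rw [godel, Nat.factorization_prod fun j _ => pow_ne_zero _ (p j).2.ne_zero, Finset.sum_apply',
    Finset.sum_eq_single i]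
  · simp [(p i).2]
  · intro j _ hj
    rw [(p j).2.factorization_pow, Finsupp.single_eq_of_ne]
    exact fun h => hj (p.injective (Subtype.ext h.symm))
  · simp

theorem godel_dvd_godel_iff {v w : ι → ℕ} : godel p v ∣ godel p w ↔ v ≤ w := by
  constructor
  · intro h i
    rw [← factorization_godel p v, ← factorization_godel p w]
    exact (Nat.factorization_le_iff_dvd (godel_ne_zero p v) (godel_ne_zero p w)).2 h _
  · intro h
    rw [← tsub_add_cancel_of_le h, godel_add]
    exact dvd_mul_left _ _

end Godel

theorem exists_embedding_sum_extending {ι κ α : Type*} [Finite ι] [Countable κ] [Infinite α]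
    (p : ι ↪ α) : ∃ q : ι ⊕ κ ↪ α, Function.Embedding.inl.trans q = p := by
  have : Infinite ↥(Set.range p)ᶜ := (Set.finite_range p).infinite_compl.to_subtype
  obtain ⟨f⟩ := nonempty_embedding_nat κ
  have f' := (f.trans (Infinite.natEmbedding ↥(Set.range p)ᶜ))
  refine ⟨⟨Sum.elim p fun k => (f' k : α), p.injective.sumElim
    (Subtype.val_injective.comp f'.injective) fun i k h => (f' k).2 ⟨i, h⟩⟩, rfl⟩

/-- A relation between the values of registers indexed by `ι` is simulable if two-counter machines
can compute it on Gödel numbers, whatever primes are used. -/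
def Simulable {ι : Type*} [Fintype ι] (R : (ι → ℕ) → (ι → ℕ) → Prop) : Prop :=
  ∀ p : ι ↪ Nat.Primes, ∃ S, Definable S ∧
    ∀ v t, S ![godel p v, 0] t ↔ ∃ w, R v w ∧ t = ![godel p w, 0]

namespace Simulable

variable {ι κ : Type*} [Fintype ι] [Fintype κ] {R S : (ι → ℕ) → (ι → ℕ) → Prop}

theorem congr (hR : Simulable R) (h : ∀ v w, R v w ↔ S v w) : Simulable S :=
  (funext₂ fun v w => propext (h v w) : R = S) ▸ hR

theorem comp (hR : Simulable R) (hS : Simulable S) : Simulable (Comp R S) := fun p => by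
  obtain ⟨R', hR', hRR'⟩ := hR p
  obtain ⟨S', hS', hSS'⟩ := hS p
  refine ⟨_, hR'.comp hS', fun v t => ⟨?_, ?_⟩⟩
  · rintro ⟨_, hvu, hut⟩
    obtain ⟨u, hu, rfl⟩ := (hRR' _ _).1 hvu
    obtain ⟨w, hw, rfl⟩ := (hSS' _ _).1 hut
    exact ⟨w, ⟨u, hu, hw⟩, rfl⟩
  · rintro ⟨w, ⟨u, hu, hw⟩, rfl⟩
    exact ⟨_, (hRR' _ _).2 ⟨u, hu, rfl⟩, (hSS' _ _).2 ⟨w, hw, rfl⟩⟩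

theorem reflTransGen (hR : Simulable R) : Simulable (ReflTransGen R) := fun p => by
  obtain ⟨R', hR', hRR'⟩ := hR p
  refine ⟨_, hR'.reflTransGen, fun v t => ⟨fun h => ?_, ?_⟩⟩
  · induction h with
    | refl => exact ⟨v, .refl, rfl⟩
    | tail _ hut ih =>
      obtain ⟨u, hu, rfl⟩ := ih
      obtain ⟨w, hw, rfl⟩ := (hRR' _ _).1 hut
      exact ⟨w, hu.tail hw, rfl⟩
  · rintro ⟨w, hw, rfl⟩
    exact hw.lift (fun v => ![godel p v, 0]) fun v w h => (hRR' v _).2 ⟨w, h, rfl⟩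

theorem check_const (b : Prop) : Simulable (check fun _ : ι → ℕ => b) := fun p => by
  by_cases hb : b
  · refine ⟨Eq, .eq, fun v t => ?_⟩
    simp only [check, hb, true_and, exists_eq_left', eq_comm]
  · refine ⟨fun _ _ => False, .false, fun v t => ?_⟩
    simp only [check, hb, false_and, exists_false]

theorem shift (d e : ι → ℕ) : Simulable (shift d e) := fun p => by
  refine ⟨_, definable_affine (godel p d) (godel p e) 0, fun v t => ⟨?_, ?_⟩⟩
  · rintro ⟨n, hn, rfl⟩
    obtain hn : godel p v = godel p d * n := congrFun hn 0
    have hle : d ≤ v := (godel_dvd_godel_iff p).1 ⟨n, hn⟩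
    refine ⟨_, ⟨v - d, (tsub_add_cancel_of_le hle).symm, rfl⟩, ?_⟩
    rw [← add_tsub_cancel_of_le hle, godel_add] at hn
    rw [godel_add, mul_left_cancel₀ (godel_ne_zero p d) hn, mul_comm, add_zero]
  · rintro ⟨_, ⟨u, rfl, rfl⟩, rfl⟩
    exact ⟨godel p u, by rw [godel_add, mul_comm, add_zero], by rw [godel_add, mul_comm, add_zero]⟩

theorem check_eq_zero (i : ι) : Simulable (check fun v : ι → ℕ => v i = 0) := fun p => by
  classical
  refine ⟨_, .exists_mem (Finset.Ioo 0 (p i : ℕ)) fun r => definable_affine (p i) (p i) r,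
    fun v t => ?_⟩
  have hdvd : (p i : ℕ) ∣ godel p v ↔ v i ≠ 0 := by
    rw [← godel_single p, godel_dvd_godel_iff, Pi.single, update_le_iff]
    simp [Nat.one_le_iff_ne_zero]
  simp only [exists_affine_iff_not_dvd (p i).2.ne_zero, hdvd, not_not, check, and_assoc,
    exists_and_left, exists_eq_left']

theorem check_forall_mem {α : Type*} (F : Finset α) {P : α → (ι → ℕ) → Prop}
    (hP : ∀ a, Simulable (check (P a))) : Simulable (check fun v => ∀ a ∈ F, P a v) := by
  classical
  induction F using Finset.induction_on with
  | empty => simpa using check_const True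
  | insert a F _ ih => simpa only [Finset.forall_mem_insert, comp_check] using (hP a).comp ih

end Simulable

/-- The relation which changes the registers in `F` arbitrarily. -/
def havoc {ι : Type*} (F : Finset ι) (v w : ι → ℕ) : Prop :=
  ∀ i ∉ F, v i = w i

section Havoc

variable {ι : Type*} [DecidableEq ι]

theorem comp_reflTransGen_shift_eq_havoc (i : ι) :
    Comp (ReflTransGen (shift (Pi.single i 1) 0)) (ReflTransGen (shift 0 (Pi.single i 1))) =
      havoc {i} := by
  ext v w
  constructor
  · rintro ⟨u, hvu, huw⟩ j hj
    obtain ⟨m, hm⟩ := exists_add_nsmul_eq_of_reflTransGen_shift hvu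
    obtain ⟨n, hn⟩ := exists_add_nsmul_eq_of_reflTransGen_shift huw
    have hm := congrFun hm j
    have hn := congrFun hn j
    rw [Finset.mem_singleton] at hj
    simp_all
  · intro h
    have update_add (v : ι → ℕ) : Function.update v i 0 + v i • Pi.single i 1 = v := by
      ext j
      rcases eq_or_ne j i with rfl | hj <;> simp [*]
    have hvw : Function.update v i 0 = Function.update w i 0 := by
      ext j
      rcases eq_or_ne j i with rfl | hj
      · simp only [Function.update_self]
      · simpa only [Function.update_of_ne hj] using h j (by simpa using hj)
    refine ⟨Function.update v i 0, ?_, ?_⟩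
    · have hv := reflTransGen_shift_add_nsmul (d := Pi.single i 1) (e := 0) (v i)
        (Function.update v i 0)
      rwa [update_add, smul_zero, add_zero] at hv
    · have hw := reflTransGen_shift_add_nsmul (d := 0) (e := Pi.single i 1) (w i)
        (Function.update w i 0)
      rwa [update_add, smul_zero, add_zero, ← hvw] at hw

theorem comp_havoc_singleton (F : Finset ι) (i : ι) :
    Comp (havoc F) (havoc {i}) = havoc (insert i F) := by
  ext v w
  simp only [Comp, havoc, Finset.mem_insert, Finset.mem_singleton, not_or, and_imp]
  constructor
  · rintro ⟨u, hvu, huw⟩ j hi hj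
    exact (hvu j hj).trans (huw j hi)
  · intro h
    refine ⟨Function.update w i (v i), fun j hj => ?_, fun j hj => by simp [hj]⟩
    rcases eq_or_ne j i with rfl | hi
    · simp only [Function.update_self]
    · simpa only [Function.update_of_ne hi] using h j hi hj

theorem havoc_map_inl_iff {ι κ : Type*} [Fintype ι] {v w : ι ⊕ κ → ℕ} :
    havoc (Finset.univ.map .inl) v w ↔ v ∘ Sum.inr = w ∘ Sum.inr := by
  simp [havoc, funext_iff]

theorem havoc_map_inr_iff {ι κ : Type*} [Fintype κ] {v w : ι ⊕ κ → ℕ} :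
    havoc (Finset.univ.map .inr) v w ↔ v ∘ Sum.inl = w ∘ Sum.inl := by
  simp [havoc, funext_iff]

end Havoc

namespace Simulable

variable {ι κ : Type*} [Fintype ι] [Fintype κ] {R S : (ι → ℕ) → (ι → ℕ) → Prop}

theorem havoc (F : Finset ι) : Simulable (havoc F) := by
  classical
  induction F using Finset.induction_on with
  | empty =>
    refine (check_const True).congr fun v w => ?_
    simp [check, _root_.havoc, funext_iff]
  | insert i F _ ih =>
    rw [← comp_havoc_singleton, ← comp_reflTransGen_shift_eq_havoc]
    exact ih.comp ((shift _ _).reflTransGen.comp (shift _ _).reflTransGen)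

/-- The registers indexed by `κ` serve as auxiliary memory. -/
theorem hide {R : (ι ⊕ κ → ℕ) → (ι ⊕ κ → ℕ) → Prop} (hR : Simulable R) :
    Simulable fun v w => R (Sum.elim v 0) (Sum.elim w 0) := fun p => by
  obtain ⟨q, rfl⟩ := exists_embedding_sum_extending (κ := κ) p
  obtain ⟨S, hS, h⟩ := hR.comp (check_forall_mem Finset.univ fun k => check_eq_zero (.inr k)) q
  refine ⟨S, hS, fun v t => ?_⟩
  rw [← godel_sumElim_zero, h]
  constructor
  · rintro ⟨_, ⟨w, hw, hw0, rfl⟩, rfl⟩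
    have hw' : w = Sum.elim (w ∘ Sum.inl) 0 := by
      ext (i | k)
      · rfl
      · exact hw0 k (Finset.mem_univ k)
    exact ⟨w ∘ Sum.inl, hw' ▸ hw, by rw [← godel_sumElim_zero, ← hw']⟩
  · rintro ⟨w, hw, rfl⟩
    exact ⟨Sum.elim w 0, ⟨_, hw, fun _ _ => rfl, rfl⟩, by rw [godel_sumElim_zero]⟩

theorem exists_sumElim {R : (ι ⊕ κ → ℕ) → (ι ⊕ κ → ℕ) → Prop} (hR : Simulable R) :
    Simulable fun v w => ∃ a b, R (Sum.elim v a) (Sum.elim w b) := by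
  have hκ := havoc (ι := ι ⊕ κ) (Finset.univ.map .inr)
  refine ((hκ.comp hR).comp hκ).hide.congr fun v w => ?_
  simp only [Comp, havoc_map_inr_iff, Sum.elim_comp_inl]
  constructor
  · rintro ⟨y, ⟨x, rfl, hxy⟩, rfl⟩
    exact ⟨x ∘ Sum.inr, y ∘ Sum.inr, by rwa [Sum.elim_comp_inl_inr, Sum.elim_comp_inl_inr]⟩
  · rintro ⟨a, b, h⟩
    exact ⟨_, ⟨_, rfl, h⟩, rfl⟩

/-- In a loop, `d` is subtracted `n` times while an auxiliary register counts to `n`. Once the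
registers in `F` are found to be zero, the loop is undone. -/
theorem check_exists_add_nsmul (d : ι → ℕ) (F : Finset ι) :
    Simulable (check fun v => ∃ (n : ℕ) (u : ι → ℕ), v = u + n • d ∧ ∀ i ∈ F, u i = 0) := by
  have hdown := (check_eq_zero (.inr ())).comp
    (shift (ι := ι ⊕ Unit) (Sum.elim d 0) (Sum.elim 0 1)).reflTransGen
  have hup := (shift (ι := ι ⊕ Unit) (Sum.elim 0 1) (Sum.elim d 0)).reflTransGen.comp
    (check_eq_zero (.inr ()))
  refine ((hdown.comp (check_forall_mem F fun i => check_eq_zero (.inl i))).comp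
    hup).exists_sumElim.congr fun v w => ?_
  simp only [Comp, check]
  constructor
  · rintro ⟨a, b, _, ⟨x, ⟨_, ⟨ha, rfl⟩, hx⟩, hF, rfl⟩, _, hxw, hb, rfl⟩
    obtain ⟨n, hn⟩ := exists_add_nsmul_eq_of_reflTransGen_shift hx
    obtain ⟨m, hm⟩ := exists_add_nsmul_eq_of_reflTransGen_shift hxw
    have hn0 := congrFun hn (.inr ())
    have hm0 := congrFun hm (.inr ())
    simp only [Pi.add_apply, Pi.smul_apply, Sum.elim_inr, Pi.zero_apply, Pi.one_apply,
      smul_eq_mul, mul_one] at hn0 hm0 ha hb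
    obtain rfl : n = m := by omega
    have hv : v = x ∘ Sum.inl + n • d := funext fun i => by simpa using congrFun hn (.inl i)
    have hw : x ∘ Sum.inl + n • d = w := funext fun i => by simpa using congrFun hm (.inl i)
    exact ⟨⟨n, _, hv, hF⟩, hv.trans hw⟩
  · rintro ⟨⟨n, u, rfl, hu⟩, rfl⟩
    have hsum (x y : ι → ℕ) (a b : Unit → ℕ) :
        Sum.elim x a + n • Sum.elim y b = Sum.elim (x + n • y) (a + n • b) := by
      ext (i | i) <;> simp
    have hdown := reflTransGen_shift_add_nsmul (M := ι ⊕ Unit → ℕ) (d := Sum.elim d 0)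
      (e := Sum.elim 0 1) n (Sum.elim u 0)
    have hup := reflTransGen_shift_add_nsmul (M := ι ⊕ Unit → ℕ) (d := Sum.elim 0 1)
      (e := Sum.elim d 0) n (Sum.elim u 0)
    simp only [hsum, smul_zero, add_zero] at hdown hup
    exact ⟨0, 0, _, ⟨_, ⟨_, ⟨rfl, rfl⟩, hdown⟩, hu, rfl⟩, _, hup, rfl, rfl⟩

theorem check_eq (i j : ι) : Simulable (check fun v : ι → ℕ => v i = v j) := by
  classical
  rcases eq_or_ne i j with rfl | hij
  · simpa only using check_const True
  convert check_exists_add_nsmul (Pi.single i 1 + Pi.single j 1) {i, j} with v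
  constructor
  · intro h
    refine ⟨v i, Function.update (Function.update v i 0) j 0, ?_, ?_⟩
    · ext l
      rcases eq_or_ne l j with rfl | hj
      · simp [h, hij]
      · rcases eq_or_ne l i with rfl | hi <;> simp [*]
    · simp [hij]
  · rintro ⟨n, u, rfl, hu⟩
    have hi : u i = 0 := hu i (by simp)
    have hj : u j = 0 := hu j (by simp)
    simp [hi, hj, hij, hij.symm]

theorem check_eq_succ (i j : ι) : Simulable (check fun v : ι → ℕ => v i = v j + 1) := by
  classical
  rcases eq_or_ne i j with rfl | hij
  · simpa using check_const False
  refine ((shift (Pi.single i 1) 0).comp ((check_eq i j).comp (shift 0 (Pi.single i 1)))).congr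
    fun v w => ?_
  simp only [Comp, check, shift_zero_left_iff, shift_zero_right_iff]
  constructor
  · rintro ⟨u, rfl, _, ⟨h, rfl⟩, rfl⟩
    simp [h, hij.symm]
  · rintro ⟨h, rfl⟩
    have hv : v = v - Pi.single i 1 + Pi.single i 1 :=
      (tsub_add_cancel_of_le (by rw [Pi.single, update_le_iff]; simp [h])).symm
    exact ⟨_, hv, _, ⟨by simp [h, hij.symm], rfl⟩, hv⟩

end Simulable

theorem reflTransGen_inr_iff {ι β : Type*} {T : (β → ℕ) → (β → ℕ) → Prop} {x y : ι ⊕ β → ℕ} :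
    ReflTransGen (fun x y : ι ⊕ β → ℕ => T (x ∘ .inr) (y ∘ .inr) ∧ ∀ i, x (.inl i) = y (.inl i))
      x y ↔ ReflTransGen T (x ∘ .inr) (y ∘ .inr) ∧ x ∘ .inl = y ∘ .inl := by
  constructor
  · intro h
    refine ⟨h.lift (· ∘ .inr) fun _ _ h => h.1, ?_⟩
    induction h with
    | refl => rfl
    | tail _ h ih => exact ih.trans (funext h.2)
  · rintro ⟨h, hxy⟩
    rw [← Sum.elim_comp_inl_inr x, ← Sum.elim_comp_inl_inr y, ← hxy]
    exact h.lift _ fun _ _ h => ⟨h, fun _ => rfl⟩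

namespace Simulable

/-- To execute a testable relation, guess the new values in auxiliary registers, test the relation
and copy the guess. -/
theorem of_check {ι : Type*} [Fintype ι] {T : (ι ⊕ ι → ℕ) → Prop} (hT : Simulable (check T)) :
    Simulable fun v w => T (Sum.elim v w) := by
  have hcopy := check_forall_mem Finset.univ fun i : ι => check_eq (Sum.inl i) (Sum.inr i)
  refine ((hT.comp (havoc (Finset.univ.map .inl))).comp hcopy).exists_sumElim.congr fun v w => ?_
  simp only [Comp, check, havoc_map_inl_iff]
  constructor
  · rintro ⟨a, b, _, ⟨_, ⟨h, rfl⟩, hab⟩, hwb, rfl⟩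
    obtain rfl : a = b := by simpa only [Sum.elim_comp_inr] using hab
    obtain rfl : w = a := funext fun i => hwb i (Finset.mem_univ i)
    exact h
  · intro h
    exact ⟨w, w, Sum.elim w w, ⟨_, ⟨h, rfl⟩, rfl⟩, fun i _ => rfl, rfl⟩

end Simulable

/-- A condition on the values of variables indexed by `α` is testable if two-counter machines can
check it on Gödel numbers, whatever registers contain the variables. One register may contain
several variables. -/
def Testable {α : Type} (P : (α → ℕ) → Prop) : Prop :=
  ∀ (ι : Type) [Fintype ι] (g : α → ι), Simulable (check fun v => P (v ∘ g))

namespace Testable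

variable {α β κ : Type} {P Q : (α → ℕ) → Prop}

theorem congr (hP : Testable P) (h : ∀ v, P v ↔ Q v) : Testable Q :=
  (funext fun v => propext (h v) : P = Q) ▸ hP

theorem comp_right (hP : Testable P) (f : α → β) : Testable fun v : β → ℕ => P (v ∘ f) :=
  fun ι _ g => hP ι (g ∘ f)

theorem eq (i j : α) : Testable fun v : α → ℕ => v i = v j :=
  fun _ _ g => .check_eq (g i) (g j)

theorem eq_succ (i j : α) : Testable fun v : α → ℕ => v i = v j + 1 :=
  fun _ _ g => .check_eq_succ (g i) (g j)

theorem eq_zero (i : α) : Testable fun v : α → ℕ => v i = 0 :=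
  fun _ _ g => .check_eq_zero (g i)

theorem and (hP : Testable P) (hQ : Testable Q) : Testable fun v => P v ∧ Q v :=
  fun ι _ g => comp_check (fun v : ι → ℕ => P (v ∘ g)) _ ▸ (hP ι g).comp (hQ ι g)

theorem forall_finite [Finite κ] {P : κ → (α → ℕ) → Prop} (hP : ∀ k, Testable (P k)) :
    Testable fun v => ∀ k, P k v := fun ι _ g => by
  cases nonempty_fintype κ
  simpa only [Finset.mem_univ, true_imp_iff] using
    Simulable.check_forall_mem Finset.univ fun k => hP k ι g

theorem exists_sumElim [Finite κ] {P : (α ⊕ κ → ℕ) → Prop} (hP : Testable P) :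
    Testable fun v => ∃ a, P (Sum.elim v a) := fun ι _ g => by
  cases nonempty_fintype κ
  refine (hP (ι ⊕ κ) (Sum.map g id)).exists_sumElim.congr fun v w => ?_
  simp only [check, Sum.elim_comp_map, Function.comp_id, Sum.elim_eq_iff]
  exact ⟨fun ⟨a, _, ha, h, _⟩ => ⟨⟨a, ha⟩, h⟩, fun ⟨⟨a, ha⟩, h⟩ => ⟨a, a, ha, h, rfl⟩⟩

theorem reflTransGen [Finite β] {T : (β ⊕ β → ℕ) → Prop} (hT : Testable T) :
    Testable fun v : β ⊕ β → ℕ =>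
      ReflTransGen (fun x y => T (Sum.elim x y)) (v ∘ Sum.inl) (v ∘ Sum.inr) := fun ι _ g => by
  cases nonempty_fintype β
  have hstep : Testable fun v : (ι ⊕ β) ⊕ (ι ⊕ β) → ℕ =>
      T (v ∘ Sum.map Sum.inr Sum.inr) ∧ ∀ i, v (.inl (.inl i)) = v (.inr (.inl i)) :=
    (hT.comp_right _).and (forall_finite fun i => eq _ _)
  have hload (f : β → ι) : Testable fun v : ι ⊕ β → ℕ => ∀ b, v (.inr b) = v (.inl (f b)) :=
    forall_finite fun b => eq _ _
  have hstar := ((hload (g ∘ Sum.inl) _ id).comp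
    (Simulable.of_check (hstep _ id)).reflTransGen).comp (hload (g ∘ Sum.inr) _ id)
  refine hstar.exists_sumElim.congr fun v w => ?_
  simp only [Comp, check, Function.comp_id, Sum.elim_comp_map, Sum.elim_inl, Sum.elim_inr]
  simp_rw [reflTransGen_inr_iff (T := fun x y => T (Sum.elim x y))]
  constructor
  · rintro ⟨a, b, _, ⟨_, ⟨ha, rfl⟩, h, hv⟩, hb, rfl⟩
    obtain rfl : v = w := hv
    obtain rfl : a = v ∘ g ∘ Sum.inl := funext ha
    obtain rfl : b = v ∘ g ∘ Sum.inr := funext hb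
    exact ⟨h, rfl⟩
  · rintro ⟨h, rfl⟩
    exact ⟨_, _, Sum.elim v _, ⟨_, ⟨fun _ => rfl, rfl⟩, h, rfl⟩, fun _ => rfl, rfl⟩

end Testable

theorem reflTransGen_iff_exists_eq {β : Type*} {T : β → β → Prop} {F : ℕ → β}
    (hT : ∀ m y, T (F m) y ↔ y = F (m + 1)) {y : β} : ReflTransGen T (F 0) y ↔ ∃ m, y = F m := by
  constructor
  · intro h
    induction h with
    | refl => exact ⟨0, rfl⟩
    | tail _ h ih =>
      obtain ⟨m, rfl⟩ := ih
      exact ⟨m + 1, (hT m _).1 h⟩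
  · rintro ⟨m, rfl⟩
    induction m with
    | zero => exact .refl
    | succ m ih => exact ih.tail ((hT m _).2 rfl)

/-- A function is testable if it can be checked, in the sense of `Testable`, that the variable
`none` has the value of the function at the other variables. -/
def TestableFun {β : Type} (f : (β → ℕ) → ℕ) : Prop :=
  Testable fun v : Option β → ℕ => v none = f (v ∘ some)

/-- The state of a loop that computes a function by primitive recursion from `f` and `g`: the number
of passes, the value reached, and the parameters. -/
def precState {n : ℕ} (f : (Fin n → ℕ) → ℕ) (g : (Fin (n + 2) → ℕ) → ℕ) (p : Fin n → ℕ) (m : ℕ) :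
    Fin (n + 2) → ℕ :=
  Fin.cons m (Fin.cons (m.rec (f p) fun m r => g (Fin.cons m (Fin.cons r p))) p)

/-- One pass of the loop with the states `precState f g p m`. -/
def PrecStep {n : ℕ} (g : (Fin (n + 2) → ℕ) → ℕ) (x y : Fin (n + 2) → ℕ) : Prop :=
  y 0 = x 0 + 1 ∧ y 1 = g x ∧ ∀ l : Fin n, y l.succ.succ = x l.succ.succ

section PrimitiveRecursion

variable {n : ℕ} {f : (Fin n → ℕ) → ℕ} {g : (Fin (n + 2) → ℕ) → ℕ} {p : Fin n → ℕ}
  {y : Fin (n + 2) → ℕ}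

theorem eq_precState_zero_iff :
    y = precState f g p 0 ↔ y 0 = 0 ∧ y 1 = f p ∧ ∀ l : Fin n, y l.succ.succ = p l := by
  simp only [funext_iff, Fin.forall_fin_succ]
  rfl

theorem precStep_precState_iff {m : ℕ} :
    PrecStep g (precState f g p m) y ↔ y = precState f g p (m + 1) := by
  simp only [funext_iff, Fin.forall_fin_succ]
  rfl

theorem reflTransGen_precStep_precState_iff :
    ReflTransGen (PrecStep g) (precState f g p 0) y ↔ ∃ m, y = precState f g p m :=
  reflTransGen_iff_exists_eq (F := precState f g p) fun _ _ => precStep_precState_iff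

end PrimitiveRecursion

namespace TestableFun

variable {α β κ : Type}

theorem testable {f : (β → ℕ) → ℕ} (hf : TestableFun f) (j : α) (i : β → α) :
    Testable fun v : α → ℕ => v j = f (v ∘ i) :=
  hf.comp_right fun o => o.elim j i

theorem proj (i : β) : TestableFun fun v => v i :=
  .eq none (some i)

theorem comp [Finite κ] {f : (κ → ℕ) → ℕ} {g : κ → (β → ℕ) → ℕ} (hf : TestableFun f)
    (hg : ∀ k, TestableFun (g k)) : TestableFun fun v => f fun k => g k v := by
  have h := (hf.testable (.inl none) (Sum.inr : κ → Option β ⊕ κ)).and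
    (.forall_finite fun k => (hg k).testable (.inr k) (Sum.inl ∘ some))
  refine h.exists_sumElim.congr fun v => ?_
  simp only [Sum.elim_inl, Sum.elim_inr, Sum.elim_comp_inr, ← funext_iff, ← Function.comp_assoc,
    Sum.elim_comp_inl, exists_eq_right]

theorem testable_precStep {n : ℕ} {g : (Fin (n + 2) → ℕ) → ℕ} (hg : TestableFun g) :
    Testable fun v : Fin (n + 2) ⊕ Fin (n + 2) → ℕ => PrecStep g (v ∘ .inl) (v ∘ .inr) :=
  (Testable.eq_succ _ _).and ((hg.testable _ _).and (.forall_finite fun _ => .eq _ _))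

theorem testable_eq_precState_zero {n : ℕ} {f : (Fin n → ℕ) → ℕ} {g : (Fin (n + 2) → ℕ) → ℕ}
    (hf : TestableFun f) (i : Fin n → α) (j : Fin (n + 2) → α) :
    Testable fun v : α → ℕ => v ∘ j = precState f g (v ∘ i) 0 := by
  simp only [eq_precState_zero_iff]
  exact (Testable.eq_zero _).and ((hf.testable _ _).and (.forall_finite fun _ => .eq _ _))

theorem prec {n : ℕ} {f : (Fin n → ℕ) → ℕ} {g : (Fin (n + 2) → ℕ) → ℕ} (hf : TestableFun f)
    (hg : TestableFun g) :
    TestableFun fun v : Fin (n + 1) → ℕ =>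
      (v 0).rec (f (Fin.tail v)) fun m r => g (Fin.cons m (Fin.cons r (Fin.tail v))) := by
  have hinit := hf.testable_eq_precState_zero (g := g)
    (Sum.inl ∘ some ∘ Fin.succ : Fin n → Option (Fin (n + 1)) ⊕ Fin (n + 2) ⊕ Fin (n + 2))
    (.inr ∘ .inl)
  have hloop := hg.testable_precStep.reflTransGen.comp_right
    (.inr : _ → Option (Fin (n + 1)) ⊕ Fin (n + 2) ⊕ Fin (n + 2))
  have hfinal : Testable fun v : Option (Fin (n + 1)) ⊕ Fin (n + 2) ⊕ Fin (n + 2) → ℕ =>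
      v (.inl (some 0)) = v (.inr (.inr 0)) ∧ v (.inl none) = v (.inr (.inr 1)) :=
    (Testable.eq _ _).and (.eq _ _)
  refine ((hinit.and hloop).and hfinal).exists_sumElim.congr fun v => ?_
  change (∃ a : Fin (n + 2) ⊕ Fin (n + 2) → ℕ,
    (a ∘ .inl = precState f g (Fin.tail (v ∘ some)) 0 ∧
      ReflTransGen (PrecStep g) (a ∘ .inl) (a ∘ .inr)) ∧
    v (some 0) = a (.inr 0) ∧ v none = a (.inr 1)) ↔
    v none = precState f g (Fin.tail (v ∘ some)) (v (some 0)) 1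
  constructor
  · rintro ⟨a, ⟨hx, hxy⟩, hm, hr⟩
    obtain ⟨m, hy⟩ := reflTransGen_precStep_precState_iff.1 (hx ▸ hxy)
    obtain rfl : v (some 0) = m := hm.trans (congrFun hy 0)
    exact hr.trans (congrFun hy 1)
  · intro h
    exact ⟨Sum.elim (precState f g _ 0) (precState f g _ (v (some 0))),
      ⟨rfl, reflTransGen_precStep_precState_iff.2 ⟨_, rfl⟩⟩, rfl, h⟩

end TestableFun

theorem testableFun_of_primrec' {n : ℕ} {f : List.Vector ℕ n → ℕ} (hf : Nat.Primrec' f) :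
    TestableFun fun v => f (.ofFn v) := by
  induction hf with
  | zero => exact Testable.eq_zero none
  | succ => exact Testable.eq_succ none (some 0)
  | get i => simpa only [List.Vector.get_ofFn] using TestableFun.proj i
  | comp _ _ _ ihf ihg => exact ihf.comp ihg
  | prec _ _ ihf ihg => exact ihf.prec ihg

theorem testable_exists_eq_zero_of_primrec₂ {f : ℕ → ℕ → ℕ} (hf : Primrec₂ f) :
    Testable fun v : Unit → ℕ => ∃ m, f (v ()) m = 0 := by
  have hf' := (testableFun_of_primrec' (Nat.Primrec'.prim_iff₂.2 hf)).testable
    (.inr 0 : Unit ⊕ Fin 2) ![.inl (), .inr 1]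
  refine (hf'.and (.eq_zero (.inr 0))).exists_sumElim.congr fun v => ?_
  change (∃ a : Fin 2 → ℕ, a 0 = f (v ()) (a 1) ∧ a 0 = 0) ↔ _
  constructor
  · rintro ⟨a, h, h0⟩
    exact ⟨a 1, h.symm.trans h0⟩
  · rintro ⟨m, hm⟩
    exact ⟨![0, m], hm.symm, rfl⟩

theorem exists_definable_of_primrec₂ {f : ℕ → ℕ → ℕ} (hf : Primrec₂ f) :
    ∃ R, Definable (k := 2) R ∧ ∀ n, (∃ t, R ![2 ^ n, 0] t) ↔ ∃ m, f n m = 0 := by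
  let p : Unit ↪ Nat.Primes := ⟨fun _ => ⟨2, Nat.prime_two⟩, Function.injective_of_subsingleton _⟩
  obtain ⟨R, hR, h⟩ := testable_exists_eq_zero_of_primrec₂ hf Unit id p
  have hp (n : ℕ) : godel p (fun _ => n) = 2 ^ n := Fintype.prod_unique _
  refine ⟨R, hR, fun n => ?_⟩
  simp only [← hp, h, check]
  exact ⟨fun ⟨_, _, ⟨hm, _⟩, _⟩ => hm, fun hm => ⟨_, _, ⟨hm, rfl⟩, rfl⟩⟩

open Nat.Partrec in
theorem exists_definable_iff_eval_dom : ∃ R, Definable (k := 2) R ∧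
    ∀ n, (∃ t, R ![2 ^ n, 0] t) ↔ (Code.eval (Denumerable.ofNat Code n) 0).Dom := by
  have hf : Primrec₂ fun n m : ℕ =>
      bif (Code.evaln m (Denumerable.ofNat Code n) 0).isSome then 0 else 1 :=
    Primrec.cond (Primrec.option_isSome.comp (Code.primrec_evaln.comp
      ((Primrec.snd.pair ((Primrec.ofNat Code).comp Primrec.fst)).pair (Primrec.const 0))))
      (Primrec.const 0) (Primrec.const 1)
  obtain ⟨R, hR, h⟩ := exists_definable_of_primrec₂ hf
  refine ⟨R, hR, fun n => (h n).trans ?_⟩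
  simp only [Part.dom_iff_mem, Code.evaln_complete, Bool.cond_eq_ite, ite_eq_left_iff,
    one_ne_zero, imp_false, not_not, Option.isSome_iff_exists, Option.mem_def]
  exact exists_comm

namespace VASS

section Semantics

variable {k : ℕ} {σ Q : Type*} [Finite σ] [Finite Q] {V : VASS k σ Q}

/-- The relation between configurations given by the transitions of `V` which read a fixed letter;
runs over a word are executions of its letters in the sense of `Exec`. -/
def Step (V : VASS k σ Q) (a : σ) (c c' : Config k Q) : Prop :=
  ∃ v, (c.1, a, v, c'.1) ∈ V.trans ∧ ∀ i, (c'.2 i : ℤ) = c.2 i + v i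

theorem exec_step_iff {w : List σ} {c c' : Config k Q} :
    Exec V.Step w c c' ↔ ∃ ρ, ρ.map Transition.letter = w ∧ V.IsRun c ρ c' := by
  constructor
  · intro h
    induction w generalizing c with
    | nil => exact ⟨[], rfl, h ▸ .nil c⟩
    | cons a w ih =>
      obtain ⟨d, ⟨v, hv, hd⟩, h⟩ := h
      obtain ⟨ρ, rfl, hρ⟩ := ih h
      exact ⟨(c.1, a, v, d.1) :: ρ, rfl, .cons hv ⟨rfl, rfl, hd⟩ hρ⟩
  · rintro ⟨ρ, rfl, h⟩
    induction h with
    | nil => rfl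
    | @cons t _ _ _ _ ht hf _ ih =>
      obtain ⟨s, a, v, s'⟩ := t
      obtain ⟨rfl, rfl, hv⟩ := hf
      exact ⟨_, ⟨_, ht, hv⟩, ih⟩

theorem mem_language_iff {w : List σ} :
    w ∈ V.language ↔ ∃ c, Exec V.Step w V.init c ∧ V.IsAccepting c := by
  simp only [exec_step_iff]
  exact ⟨fun ⟨ρ, hw, c, hρ, hc⟩ => ⟨c, ⟨ρ, hw, hρ⟩, hc⟩,
    fun ⟨c, ⟨ρ, hw, hρ⟩, hc⟩ => ⟨ρ, hw, c, hρ, hc⟩⟩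

theorem isAccepting_iff_mem {F : Set Q} (hF : ∀ d, d ∈ V.final ↔ d.1 ∈ F ∧ d.2 = 0)
    {c : Config k Q} : V.IsAccepting c ↔ c.1 ∈ F := by
  constructor
  · rintro ⟨d, hd, hdc, -⟩
    exact hdc ▸ ((hF d).1 hd).1
  · intro hc
    exact ⟨(c.1, 0), (hF _).2 ⟨hc, rfl⟩, rfl, zero_le⟩

/-- A VASS is deterministic if its transitions are determined by source state and letter. -/
def IsDeterministic (V : VASS k σ Q) : Prop :=
  ∀ ⦃s a v v' t t'⦄, (s, a, v, t) ∈ V.trans → (s, a, v', t') ∈ V.trans → v = v' ∧ t = t'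

theorem IsDeterministic.eq_of_isRun (hV : V.IsDeterministic) {ρ ρ' : List (Transition k σ Q)}
    {c d d' : Config k Q} (h : V.IsRun c ρ d) (h' : V.IsRun c ρ' d')
    (hρ : ρ.map Transition.letter = ρ'.map Transition.letter) : ρ = ρ' := by
  induction h generalizing ρ' with
  | nil => exact (List.map_eq_nil_iff.1 hρ.symm).symm
  | @cons t _ _ _ _ ht hf _ ih =>
    cases h' with
    | nil => cases hρ
    | @cons t' _ _ _ _ ht' hf' h' =>
      obtain ⟨s, a, v, r⟩ := t
      obtain ⟨s', a', v', r'⟩ := t'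
      obtain ⟨⟨rfl⟩, hρ'⟩ := List.cons.inj hρ
      obtain ⟨rfl, hs, hv⟩ := hf
      obtain ⟨rfl, hs', hv'⟩ := hf'
      obtain ⟨rfl, rfl⟩ := hV ht ht'
      have hc := Prod.ext (hs'.trans hs.symm)
        (funext fun i => Int.ofNat.inj ((hv' i).trans (hv i).symm))
      rw [ih (hc ▸ h') hρ']

theorem IsDeterministic.isUnambiguous (hV : V.IsDeterministic) : V.IsUnambiguous := by
  rintro w ⟨ρ, hw, c, hρ, hc⟩
  exact ⟨ρ, ⟨hw, c, hρ, hc⟩, fun ρ' ⟨hw', _, hρ', _⟩ =>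
    hV.eq_of_isRun hρ' hρ (hw'.trans hw.symm)⟩

end Semantics

section Reindex

variable {k : ℕ} {σ σ' Q Q' : Type*} [Finite σ] [Finite σ'] [Finite Q] [Finite Q']
  {V : VASS k σ Q} {e : σ ≃ σ'} {g : Q ≃ Q'}

/-- The VASS obtained from `V` by renaming the letters and the states. -/
def reindex (V : VASS k σ Q) (e : σ ≃ σ') (g : Q ≃ Q') : VASS k σ' Q' where
  init := (g V.init.1, V.init.2)
  final := V.final.map (g.prodCongr (.refl _)).toEmbedding
  trans := V.trans.map (g.prodCongr (e.prodCongr (.prodCongr (.refl _) g))).toEmbedding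

theorem mem_trans_reindex_iff {s t : Q} {a : σ} {v : Fin k → ℤ} :
    (g s, e a, v, g t) ∈ (V.reindex e g).trans ↔ (s, a, v, t) ∈ V.trans :=
  Finset.mem_map' (g.prodCongr (e.prodCongr (.prodCongr (.refl _) g))).toEmbedding
    (a := (s, a, v, t))

theorem isAccepting_reindex_iff {q : Q} {u : Fin k → ℕ} :
    (V.reindex e g).IsAccepting (g q, u) ↔ V.IsAccepting (q, u) := by
  simp [IsAccepting, reindex]

theorem exec_reindex_iff {w : List σ} {s t : Q} {u v : Fin k → ℕ} :
    Exec (V.reindex e g).Step (w.map e) (g s, u) (g t, v) ↔ Exec V.Step w (s, u) (t, v) := by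
  induction w generalizing s u with
  | nil => simp [Exec]
  | cons a w ih =>
    simp only [List.map_cons, Exec, Step, Prod.exists, ← g.exists_congr_right,
      mem_trans_reindex_iff, ih]

theorem language_reindex : (V.reindex e g).language = Language.map e V.language := by
  ext w
  obtain ⟨w, rfl⟩ := (List.map_surjective_iff.2 e.surjective) w
  have hmap : w.map e ∈ Language.map e V.language ↔ w ∈ V.language :=
    (List.map_injective_iff.2 e.injective).mem_set_image
  simp only [hmap, mem_language_iff, Prod.exists, ← g.exists_congr_right, isAccepting_reindex_iff]
  exact exists₂_congr fun _ _ => and_congr_left' exec_reindex_iff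

theorem language_reindex_eq_iff {Q₂ Q₂' : Type*} [Finite Q₂] [Finite Q₂'] {W : VASS k σ Q₂}
    {g₂ : Q₂ ≃ Q₂'} :
    (V.reindex e g).language = (W.reindex e g₂).language ↔ V.language = W.language := by
  rw [language_reindex, language_reindex]
  exact ((List.map_injective_iff.2 e.injective).image_injective).eq_iff

theorem IsDeterministic.reindex (hV : V.IsDeterministic) : (V.reindex e g).IsDeterministic := by
  intro s a v v' t t' h h'
  obtain ⟨s, rfl⟩ := g.surjective s
  obtain ⟨t, rfl⟩ := g.surjective t
  obtain ⟨t', rfl⟩ := g.surjective t'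
  obtain ⟨a, rfl⟩ := e.surjective a
  rw [mem_trans_reindex_iff] at h h'
  exact (hV h h').imp_right (congrArg g)

end Reindex

section Inter

variable {k : ℕ} {σ Q P : Type*} [Finite σ] [Finite Q] [Fintype P]

open Classical in
/-- The product of a VASS and a finite automaton. -/
noncomputable def inter (V : VASS k σ Q) (D : DFA σ P) : VASS k σ (Q × P) where
  init := ((V.init.1, D.start), V.init.2)
  final := (V.final ×ˢ Finset.univ.filter (· ∈ D.accept)).image fun x => ((x.1.1, x.2), x.1.2)
  trans := (V.trans ×ˢ Finset.univ).image fun x =>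
    ((x.1.1, x.2), x.1.2.1, x.1.2.2.1, (x.1.2.2.2, D.step x.2 x.1.2.1))

variable {V : VASS k σ Q} {D : DFA σ P}

theorem mem_trans_inter_iff {s t : Q} {p r : P} {a : σ} {v : Fin k → ℤ} :
    ((s, p), a, v, (t, r)) ∈ (V.inter D).trans ↔ (s, a, v, t) ∈ V.trans ∧ r = D.step p a := by
  simp [inter, eq_comm]

theorem isAccepting_inter_iff {q : Q} {p : P} {u : Fin k → ℕ} :
    (V.inter D).IsAccepting ((q, p), u) ↔ V.IsAccepting (q, u) ∧ p ∈ D.accept := by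
  simp only [IsAccepting, inter, Finset.mem_image, Finset.mem_product, Finset.mem_filter,
    Finset.mem_univ, true_and]
  constructor
  · rintro ⟨_, ⟨⟨d, p⟩, ⟨hd, hp⟩, rfl⟩, hq, hu⟩
    obtain ⟨rfl, rfl⟩ := Prod.mk.inj hq
    exact ⟨⟨d, hd, rfl, hu⟩, hp⟩
  · rintro ⟨⟨d, hd, rfl, hu⟩, hp⟩
    exact ⟨_, ⟨⟨d, p⟩, ⟨hd, hp⟩, rfl⟩, rfl, hu⟩

theorem step_inter_iff {a : σ} {s t : Q} {p r : P} {u v : Fin k → ℕ} :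
    (V.inter D).Step a ((s, p), u) ((t, r), v) ↔ V.Step a (s, u) (t, v) ∧ r = D.step p a := by
  simp only [Step, mem_trans_inter_iff]
  exact ⟨fun ⟨x, ⟨hx, hr⟩, hv⟩ => ⟨⟨x, hx, hv⟩, hr⟩, fun ⟨⟨x, hx, hv⟩, hr⟩ => ⟨x, ⟨hx, hr⟩, hv⟩⟩

theorem exec_inter_iff {w : List σ} {s t : Q} {p r : P} {u v : Fin k → ℕ} :
    Exec (V.inter D).Step w ((s, p), u) ((t, r), v) ↔
      Exec V.Step w (s, u) (t, v) ∧ r = D.evalFrom p w := by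
  induction w generalizing s p u with
  | nil => simp [Exec, eq_comm, and_right_comm]
  | cons a w ih =>
    simp only [Exec, Prod.exists, step_inter_iff, ih, DFA.evalFrom_cons]
    constructor
    · rintro ⟨q, _, x, ⟨h, rfl⟩, h', hr⟩
      exact ⟨⟨q, x, h, h'⟩, hr⟩
    · rintro ⟨⟨q, x, h, h'⟩, hr⟩
      exact ⟨q, _, x, ⟨h, rfl⟩, h', hr⟩

theorem mem_language_inter_iff {w : List σ} :
    w ∈ (V.inter D).language ↔ w ∈ V.language ∧ w ∈ D.accepts := by
  simp only [mem_language_iff, Prod.exists, isAccepting_inter_iff, DFA.mem_accepts]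
  constructor
  · rintro ⟨q, _, u, h, hq, hr⟩
    obtain ⟨hV, rfl⟩ := exec_inter_iff.1 h
    exact ⟨⟨q, u, hV, hq⟩, hr⟩
  · rintro ⟨⟨q, u, h, hq⟩, hr⟩
    exact ⟨q, _, u, exec_inter_iff.2 ⟨h, rfl⟩, hq, hr⟩

theorem IsDeterministic.inter (hV : V.IsDeterministic) : (V.inter D).IsDeterministic := by
  rintro ⟨s, p⟩ a v v' ⟨t, r⟩ ⟨t', r'⟩ h h'
  rw [mem_trans_inter_iff] at h h'
  obtain ⟨rfl, rfl⟩ := hV h.1 h'.1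
  exact ⟨rfl, by rw [h.2, h'.2]⟩

end Inter

end VASS

namespace CounterAction

variable {k : ℕ} {a : CounterAction k} {s t t' : Fin k → ℕ}

/-- The effect of an instruction on the counters as a vector, where zero tests have no effect. -/
def effect : CounterAction k → Fin k → ℤ
  | inc i => Pi.single i 1
  | dec i => -Pi.single i 1
  | test _ => 0

/-- The execution of an instruction by a machine that ignores zero tests. -/
def RelaxedStep (a : CounterAction k) (s t : Fin k → ℕ) : Prop :=
  ∀ i, (t i : ℤ) = s i + a.effect i

theorem RelaxedStep.right_unique (h : a.RelaxedStep s t) (h' : a.RelaxedStep s t') : t = t' :=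
  funext fun i => Int.ofNat.inj ((h i).trans (h' i).symm)

theorem relaxedStep_test_iff {i : Fin k} : (test i).RelaxedStep s t ↔ s = t := by
  simp [RelaxedStep, effect, funext_iff, eq_comm]

theorem step_iff : a.Step s t ↔ a.RelaxedStep s t ∧ ∀ i, a = test i → s i = 0 := by
  cases a with
  | inc i =>
    simp only [Step, shift_zero_left_iff, RelaxedStep, effect, funext_iff, Pi.add_apply,
      Pi.single_apply, reduceCtorEq, false_imp_iff, implies_true, and_true]
    exact forall_congr' fun j => by split <;> lia
  | dec i =>
    simp only [Step, shift_zero_right_iff, RelaxedStep, effect, funext_iff, Pi.add_apply,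
      Pi.neg_apply, Pi.single_apply, reduceCtorEq, false_imp_iff, implies_true, and_true]
    exact forall_congr' fun j => by split <;> lia
  | test i =>
    simp [Step, check, relaxedStep_test_iff, and_comm]

end CounterAction

namespace VASS

open CounterAction

variable {k : ℕ}

/-- The VASS that executes the sequences of instructions, but ignores the zero tests. -/
noncomputable def relaxation (u : Fin k → ℕ) : VASS k (CounterAction k) Unit where
  init := ((), u)
  final := {((), 0)}
  trans := (Set.finite_range fun a => ((), a, a.effect, ())).toFinset

variable {u : Fin k → ℕ} {w : List (CounterAction k)}

theorem mem_trans_relaxation_iff {a : CounterAction k} {v : Fin k → ℤ} {x y : Unit} :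
    (x, a, v, y) ∈ (relaxation u).trans ↔ v = a.effect := by
  simp [relaxation, eq_comm]

theorem exec_relaxation_iff {c c' : Config k Unit} :
    Exec (relaxation u).Step w c c' ↔ Exec RelaxedStep w c.2 c'.2 := by
  induction w generalizing c with
  | nil => simp [Exec, Prod.ext_iff]
  | cons a w ih =>
    simp only [Exec, Prod.exists, Unique.exists_iff, Step, mem_trans_relaxation_iff,
      exists_eq_left, ih, RelaxedStep]

theorem mem_language_relaxation_iff :
    w ∈ (relaxation u).language ↔ ∃ t, Exec RelaxedStep w u t := by
  have hacc (c) : (relaxation u).IsAccepting c := ⟨((), 0), by simp [relaxation], rfl, zero_le⟩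
  simp only [mem_language_iff, hacc, and_true, exec_relaxation_iff, Prod.exists,
    Unique.exists_iff]
  rfl

theorem isDeterministic_relaxation : (relaxation u).IsDeterministic := by
  intro s a v v' t t' h h'
  rw [mem_trans_relaxation_iff] at h h'
  exact ⟨h.trans h'.symm, rfl⟩

/-- The phases of the search for a test of a positive counter: the test is still to come, it was
the last instruction, or it was earlier. The test of the counter `i` is certified by holding one
unit of that counter until the next instruction. -/
inductive Phase (k : ℕ)
  | waiting
  | holding (i : Fin k)
  | done

namespace Phase

instance : Finite (Phase k) :=
  .of_surjective (Option.elim · waiting (Option.elim · done holding)) fun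
    | waiting => ⟨none, rfl⟩
    | holding i => ⟨some (some i), rfl⟩
    | done => ⟨some none, rfl⟩

/-- The units of the counters that are held. -/
def hold : Phase k → Fin k → ℕ
  | holding i => Pi.single i 1
  | _ => 0

/-- The changes of the phase. -/
inductive Next : Phase k → CounterAction k → Phase k → Prop
  | wait (a : CounterAction k) : Next waiting a waiting
  | hold (i : Fin k) : Next waiting (test i) (holding i)
  | release (i : Fin k) (a : CounterAction k) : Next (holding i) a done
  | finish (a : CounterAction k) : Next done a done

end Phase

open Phase

/-- The VASS that executes the sequences of instructions in which some positive counter is tested.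
Like `relaxation`, it ignores the other tests. -/
noncomputable def violations (u : Fin k → ℕ) : VASS k (CounterAction k) (Phase k) where
  init := (waiting, u)
  final := (Set.toFinite ({waiting}ᶜ ×ˢ {0})).toFinset
  trans := (Set.toFinite ((fun x : Phase k × CounterAction k × Phase k =>
    (x.1, x.2.1, fun i => x.2.1.effect i + x.1.hold i - x.2.2.hold i, x.2.2)) ''
      {x | x.1.Next x.2.1 x.2.2})).toFinset

theorem step_violations_iff {a : CounterAction k} {x y : Phase k} {s t : Fin k → ℕ} :
    (violations u).Step a (x, s) (y, t) ↔
      x.Next a y ∧ a.RelaxedStep (s + x.hold) (t + y.hold) := by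
  simp only [Step, violations, Set.Finite.mem_toFinset, Set.mem_image, Set.mem_ofPred_eq,
    Prod.exists, Prod.mk.injEq, RelaxedStep, Pi.add_apply]
  constructor
  · rintro ⟨v, ⟨x, a, y, hxy, rfl, rfl, rfl, rfl⟩, h⟩
    exact ⟨hxy, fun i => by push_cast [h i]; ring⟩
  · rintro ⟨hxy, h⟩
    refine ⟨_, ⟨x, a, y, hxy, rfl, rfl, rfl, rfl⟩, fun i => ?_⟩
    have hi := h i
    push_cast at hi
    linarith

theorem exists_exec_violations_iff_of_ne_waiting {x : Phase k} (hx : x ≠ waiting)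
    {s : Fin k → ℕ} :
    (∃ y t, y ≠ waiting ∧ Exec (violations u).Step w (x, s) (y, t)) ↔
      ∃ t, Exec RelaxedStep w (s + x.hold) t := by
  induction w generalizing x s with
  | nil => exact ⟨fun _ => ⟨_, rfl⟩, fun _ => ⟨x, s, hx, rfl⟩⟩
  | cons a w ih =>
    simp only [Exec, Prod.exists, step_violations_iff]
    constructor
    · rintro ⟨y, t, hy, z, r, ⟨hz, hr⟩, h⟩
      have hz : z ≠ waiting := by rintro rfl; cases hz; exact hx rfl
      obtain ⟨t, ht⟩ := (ih hz).1 ⟨y, t, hy, h⟩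
      exact ⟨t, _, hr, ht⟩
    · rintro ⟨t, r, hr, h⟩
      have hnext : x.Next a done := by cases x <;> first | contradiction | constructor
      obtain ⟨y, t, hy, h⟩ := (ih (x := done) (s := r) (by simp)).2 ⟨t, h⟩
      exact ⟨y, t, hy, done, r, ⟨hnext, hr⟩, h⟩

theorem exists_exec_violations_iff {s : Fin k → ℕ} :
    (∃ y t, y ≠ waiting ∧ Exec (violations u).Step w (waiting, s) (y, t)) ↔
      (∃ t, Exec RelaxedStep w s t) ∧ ¬ ∃ t, Exec CounterAction.Step w s t := by
  induction w generalizing s with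
  | nil => simp [Exec]
  | cons a w ih =>
    simp only [Exec, Prod.exists, step_violations_iff]
    constructor
    · rintro ⟨y, t, hy, z, r, ⟨hz, hr⟩, h⟩
      cases hz with
      | wait =>
        obtain ⟨⟨t', ht'⟩, hw⟩ := ih.1 ⟨y, t, hy, h⟩
        refine ⟨⟨t', r, hr, ht'⟩, ?_⟩
        rintro ⟨t'', r', hr', ht''⟩
        obtain rfl := hr.right_unique (step_iff.1 hr').1
        exact hw ⟨t'', ht''⟩
      | hold i =>
        obtain ⟨t', ht'⟩ := (exists_exec_violations_iff_of_ne_waiting (by simp)).1 ⟨y, t, hy, h⟩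
        refine ⟨⟨t', _, hr, ht'⟩, ?_⟩
        rintro ⟨_, _, hr', -⟩
        have hs := congrFun (relaxedStep_test_iff.1 hr) i
        have hi := (step_iff.1 hr').2 i rfl
        simp [Phase.hold, hi] at hs
    · rintro ⟨⟨t, r, hr, h⟩, hw⟩
      by_cases ha : ∀ i, a = test i → s i = 0
      · obtain ⟨y, t, hy, h⟩ := ih.2 ⟨⟨t, h⟩, fun ⟨t, ht⟩ => hw ⟨t, r, step_iff.2 ⟨hr, ha⟩, ht⟩⟩
        exact ⟨y, t, hy, waiting, r, ⟨.wait a, hr⟩, h⟩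
      · push Not at ha
        obtain ⟨i, rfl, hi⟩ := ha
        obtain rfl := relaxedStep_test_iff.1 hr
        have hs : s - Pi.single i 1 + (holding i).hold = s :=
          tsub_add_cancel_of_le fun j => by
            rcases eq_or_ne j i with rfl | hj
            · simpa using Nat.one_le_iff_ne_zero.2 hi
            · simp [hj]
        obtain ⟨y, t, hy, h'⟩ :=
          (exists_exec_violations_iff_of_ne_waiting (u := u) (x := holding i) nofun).2
            ⟨t, hs.symm ▸ h⟩
        exact ⟨y, t, hy, holding i, _, ⟨.hold i, relaxedStep_test_iff.2 hs.symm⟩, h'⟩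

theorem mem_language_violations_iff :
    w ∈ (violations u).language ↔
      (∃ t, Exec RelaxedStep w u t) ∧ ¬ ∃ t, Exec CounterAction.Step w u t := by
  have hacc (c) : (violations u).IsAccepting c ↔ c.1 ≠ waiting :=
    isAccepting_iff_mem (F := {waiting}ᶜ) fun d => by simp [violations]
  simp only [mem_language_iff, hacc, ← exists_exec_violations_iff (u := u), Prod.exists,
    and_comm]
  rfl

theorem language_relaxation_inter_eq_iff {P : Type*} [Fintype P] {D : DFA (CounterAction k) P} :
    ((relaxation u).inter D).language = ((violations u).inter D).language ↔
      ¬ ∃ t, ∃ w ∈ D.accepts, Exec CounterAction.Step w u t := by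
  have hrel (w t) (h : Exec CounterAction.Step w u t) : Exec RelaxedStep w u t :=
    h.mono fun _ _ _ h => (step_iff.1 h).1
  simp only [Language.ext_iff, mem_language_inter_iff, mem_language_relaxation_iff,
    mem_language_violations_iff]
  constructor
  · rintro h ⟨t, w, hw, ht⟩
    exact ((h w).1 ⟨⟨t, hrel w t ht⟩, hw⟩).1.2 ⟨t, ht⟩
  · intro h w
    exact and_congr_left fun hw => (and_iff_left fun ⟨t, ht⟩ => h ⟨t, w, hw, ht⟩).symm

end VASS

namespace VASS

section Code

variable {k m n : ℕ}

/-- The description which lists the final configurations and the transitions of a VASS. -/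
noncomputable def toCode (V : VASS k (Fin m) (Fin n)) : Code k :=
  (m, n, (V.init.1, V.init.2), V.final.toList.map fun d => ((d.1 : ℕ), d.2),
    V.trans.toList.map fun s => ((s.1 : ℕ), (s.2.1 : ℕ), s.2.2.1, (s.2.2.2 : ℕ)))

theorem describes_toCode (V : VASS k (Fin m) (Fin n)) : Describes V.toCode V := by
  refine ⟨rfl, rfl, rfl, fun c => ?_, fun t => ?_⟩ <;>
    simp only [List.mem_map, Finset.mem_toList, eq_comm]

/-- The VASS `V` with the counter values `u` in its initial configuration. -/
def withCounters (V : VASS k (Fin m) (Fin n)) (u : Fin k → ℕ) : VASS k (Fin m) (Fin n) :=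
  { V with init := (V.init.1, u) }

theorem primrec_toCode_withCounters (V : VASS k (Fin m) (Fin n)) :
    Primrec fun u => (V.withCounters u).toCode :=
  (Primrec.const m).pair <| (Primrec.const n).pair <|
    ((Primrec.const (V.init.1 : ℕ)).pair Primrec.id).pair <| Primrec.const V.toCode.2.2.2

end Code

theorem exists_language_eq_iff_of_definable {k : ℕ} {R : (Fin k → ℕ) → (Fin k → ℕ) → Prop}
    (hR : Definable R) :
    ∃ (m n n' : ℕ) (A : VASS k (Fin m) (Fin n)) (B : VASS k (Fin m) (Fin n')),
      A.IsDeterministic ∧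
        ∀ u, (A.withCounters u).language = (B.withCounters u).language ↔ ¬ ∃ t, R u t := by
  obtain ⟨_, ⟨P, _, D, rfl⟩, hR⟩ := hR
  obtain ⟨m, ⟨e⟩⟩ := Finite.exists_equiv_fin (CounterAction k)
  obtain ⟨n, ⟨g⟩⟩ := Finite.exists_equiv_fin (Unit × P)
  obtain ⟨n', ⟨g'⟩⟩ := Finite.exists_equiv_fin (Phase k × P)
  refine ⟨m, n, n', ((relaxation 0).inter D).reindex e g, ((violations 0).inter D).reindex e g',
    isDeterministic_relaxation.inter.reindex, fun u => ?_⟩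
  simp only [hR, ← language_relaxation_inter_eq_iff]
  exact language_reindex_eq_iff (V := (relaxation u).inter D) (W := (violations u).inter D)

end VASS

theorem primrec_two_pow_zero : Primrec fun n : ℕ => (![2 ^ n, 0] : Fin 2 → ℕ) := by
  have hpow : Primrec fun n : ℕ => 2 ^ n :=
    (Primrec.nat_rec₁ 1 (Primrec.nat_mul.comp Primrec.snd (Primrec.const 2)).to₂).of_eq fun n => by
      induction n with
      | zero => rfl
      | succ n ih => rw [pow_succ, ← ih]
  refine Primrec.fin_curry.2 <| (Primrec.ite (c := fun p : ℕ × Fin 2 => p.2 = 0)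
    (Primrec.eq.comp Primrec.snd (Primrec.const 0)) (hpow.comp Primrec.fst)
    (Primrec.const 0)).of_eq ?_
  rintro ⟨n, i⟩
  fin_cases i <;> rfl

open Nat.Partrec in
theorem not_computable_eval_dom {r : ℕ → Bool} (hr : Computable r) :
    ¬ ∀ n, r n = true ↔ ¬ (Code.eval (Denumerable.ofNat Code n) 0).Dom := by
  intro h
  refine ComputablePred.halting_problem 0 <| ComputablePred.computable_iff.2
    ⟨fun c => !r (Encodable.encode c),
      Primrec.not.to_comp.comp (hr.comp Computable.encode), funext fun c => propext ?_⟩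
  rw [Bool.not_eq_true', ← Bool.not_eq_true, h, Denumerable.ofNat_encode, not_not]

theorem corollary4_general :
    ¬ ∃ f : VASS.Code 2 × VASS.Code 2 →. Bool, Partrec f ∧
      ∀ (m n n' : ℕ) (A : VASS 2 (Fin m) (Fin n)) (B : VASS 2 (Fin m) (Fin n'))
        (a b : VASS.Code 2), VASS.Describes a A → VASS.Describes b B → A.IsDeterministic →
          ∃ r ∈ f (a, b), (r = true ↔ A.language = B.language) := by
  rintro ⟨f, hf, h⟩
  obtain ⟨R, hR, hhalt⟩ := exists_definable_iff_eval_dom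
  obtain ⟨m, n, n', A, B, hA, hAB⟩ := VASS.exists_language_eq_iff_of_definable hR
  have hcode : Computable fun x : ℕ => ((A.withCounters ![2 ^ x, 0]).toCode,
      (B.withCounters ![2 ^ x, 0]).toCode) :=
    ((A.primrec_toCode_withCounters.comp primrec_two_pow_zero).pair
      (B.primrec_toCode_withCounters.comp primrec_two_pow_zero)).to_comp
  choose r hr hr' using fun x : ℕ => h m n n' (A.withCounters ![2 ^ x, 0])
    (B.withCounters ![2 ^ x, 0]) _ _ (VASS.describes_toCode _) (VASS.describes_toCode _) hA
  have hcomp : Computable r := (hf.comp hcode).of_eq fun x => Part.eq_some_iff.2 (hr x)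
  exact not_computable_eval_dom hcomp fun x => by rw [hr', hAB, hhalt]

/-- No algorithm (partial recursive function), given descriptions of a 2-VASS `A` and a 2-VASS `B`
over a common finite alphabet such that `A` is unambiguous, always halts and correctly answers
whether `L(A) = L(B)`. Its behaviour on all other inputs is unrestricted. -/
theorem corollary4 :
    ¬ ∃ f : VASS.Code 2 × VASS.Code 2 →. Bool, Partrec f ∧
      ∀ (m n n' : ℕ) (A : VASS 2 (Fin m) (Fin n)) (B : VASS 2 (Fin m) (Fin n'))
        (a b : VASS.Code 2), VASS.Describes a A → VASS.Describes b B → A.IsUnambiguous →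
          ∃ r ∈ f (a, b), (r = true ↔ A.language = B.language) := fun ⟨f, hf, h⟩ =>
  corollary4_general ⟨f, hf, fun m n n' A B a b ha hb hA =>
    h m n n' A B a b ha hb hA.isUnambiguous⟩
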